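/- Let $|\Psi_{1,2}\rangle=\frac{1}{\sqrt2}(|00\rangle\pm|11\rangle)$ and $|\Psi_{3,4}\rangle=\frac{1}{\sqrt2}(|01\rangle\pm|10\rangle)$ be the Bell states, let $\lambda\in(0,1]$, let $\varsigma$ be any two-qubit density matrix, and let $\mathcal B_{\lambda,\varsigma}$ be the ensemble of the four equiprobable states $\varrho_i=\lambda|\Psi_i\rangle\langle\Psi_i|+(1-\lambda)\varsigma$, $i=1,\dots,4$, each shared between Alice (first qubit) and Bob (second qubit). For an ensemble $\mathcal E=\{(p_i,\rho_i)\}$ of bipartite states let $p(\mathcal E)$ and $p_{\mathrm L}(\mathcal E)$ be the suprema of the average success probability $\sum_i p_i\operatorname{Tr}(\rho_iM_i)$ over all measurements $\{M_i\}$ and over all measurements implementable by local operations and finitely many rounds of classical communication (LOCC), respectively. For a bipartite pure ancilla state $|\tau\rangle\in\mathbb C^m\otimes\mathbb C^n$ put $\mathcal E\otimes\tau=\{(p_i,\rho_i\otimes|\tau\rangle\langle\tau|)\}$, where Alice holds her part of $\rho_i$ and the factor $\mathbb C^m$, and Bob holds the rest. Call $|\tau\rangle$ an optimal resource for $\mathcal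 E$ if $p_{\mathrm L}(\mathcal E\otimes\tau)=p(\mathcal E)$ and if every bipartite pure state $|\tau'\rangle\in\mathbb C^{m'}\otimes\mathbb C^{n'}$ (with $m',n'$ arbitrary) with $p_{\mathrm L}(\mathcal E\otimes\tau')=p(\mathcal E)$ satisfies $E(\tau)\le E(\tau')$ and $mn\le m'n'$, where $E$ is the entanglement entropy (logarithms to base 2). The entanglement cost of discriminating $\mathcal E$ by LOCC is the value $E(\tau)$ of an optimal resource, in ebits; it is well defined once an optimal resource exists. Then the entanglement cost of discriminating $\mathcal B_{\lambda,\varsigma}$ by LOCC is exactly $1$ ebit. Moreover, with $|\tau_\varepsilon\rangle=\sqrt{\tfrac{1+\varepsilon}{2}}\,|00\rangle+\sqrt{\tfrac{1-\varepsilon}{2}}\,|11\rangle$ for $\varepsilon\in[0,1]$, the Bell state $|\tau_0\rangle$ is an optimal resource for $\mathcal B_{\lambda,\varsigma}$, and $p_{\mathrm L}(\mathcal B_{\lambda,\varsigma}\otimes\tau_\varepsilon)=p(\mathcal B_{\lambda,\varsigma})$ if and only if $\varepsilon=0$. -/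

import Mathlib

open scoped Kronecker Matrix ComplexOrder

noncomputable section

namespace NoisyBell

/-- The reduced density matrix on Alice's side of the pure state `ψ`. -/
def reducedState {α β : Type} [Fintype β] (ψ : α × β → ℂ) : Matrix α α ℂ :=
  Matrix.of fun a a' => ∑ b, ψ (a, b) * star (ψ (a', b))

theorem reducedState_isHermitian {α β : Type} [Fintype β] (ψ : α × β → ℂ) :
    (reducedState ψ).IsHermitian := by
  ext a a'
  simp [reducedState, Matrix.conjTranspose_apply, mul_comm]

section General

variable {ι α β α' β' : Type} [Fintype ι] [DecidableEq ι] [Fintype α] [DecidableEq α]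
  [Fintype β] [DecidableEq β] [Fintype α'] [DecidableEq α'] [Fintype β'] [DecidableEq β']

/-- A density matrix: positive semidefinite with unit trace. -/
def IsDensityMatrix (ρ : Matrix α α ℂ) : Prop :=
  ρ.PosSemidef ∧ ρ.trace = 1

/-- A unit vector, that is, a pure state given in the standard basis. -/
def IsUnitVector (ψ : α → ℂ) : Prop :=
  ∑ a, ‖ψ a‖ ^ 2 = 1

/-- The rank-one operator `|ψ⟩⟨ψ|`. -/
def ketbra (ψ : α → ℂ) : Matrix α α ℂ :=
  Matrix.vecMulVec ψ (star ψ)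

/-- A measurement (POVM) with outcomes in `ι`. -/
def IsMeasurement (M : ι → Matrix α α ℂ) : Prop :=
  (∀ i, (M i).PosSemidef) ∧ ∑ i, M i = 1

/-- The measurements on a bipartite system (Alice holds `α`, Bob holds `β`) that are implementable
by local operations and finitely many rounds of classical communication.

* `guess`: the parties stop and announce the outcome `j`.
* `alice`: Alice applies a quantum instrument to her system, with Kraus operators
  `A k : ℂ^α → ℂ^(d k)`, and broadcasts the outcome `k`; the parties go on with an LOCC measurement
  `N k` of the resulting system, chosen according to `k`. (An instrument with several Kraus
  operators for the same outcome, a local channel or a shared coin toss is the special case in which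
  `N k` does not depend on part of the label `k`.)
* `bob`: the same with the roles exchanged.

The indexed family of operators is the POVM induced on the initial system. -/
inductive IsLOCC {ι : Type} [DecidableEq ι] :
    (α β : Type) → [Fintype α] → [DecidableEq α] → [Fintype β] → [DecidableEq β] →
    (ι → Matrix (α × β) (α × β) ℂ) → Prop
  | guess {α β : Type} [Fintype α] [DecidableEq α] [Fintype β] [DecidableEq β] (j : ι) :
      IsLOCC α β (fun i => if i = j then 1 else 0)
  | alice {α β : Type} [Fintype α] [DecidableEq α] [Fintype β] [DecidableEq β]
      (K : ℕ) (d : Fin K → ℕ) (A : (k : Fin K) → Matrix (Fin (d k)) α ℂ)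
      (hA : ∑ k, (A k)ᴴ * A k = 1)
      (N : (k : Fin K) → ι → Matrix (Fin (d k) × β) (Fin (d k) × β) ℂ)
      (hN : ∀ k, IsLOCC (Fin (d k)) β (N k)) :
      IsLOCC α β (fun i => ∑ k,
        (A k ⊗ₖ (1 : Matrix β β ℂ))ᴴ * N k i * (A k ⊗ₖ (1 : Matrix β β ℂ)))
  | bob {α β : Type} [Fintype α] [DecidableEq α] [Fintype β] [DecidableEq β]
      (K : ℕ) (d : Fin K → ℕ) (B : (k : Fin K) → Matrix (Fin (d k)) β ℂ)
      (hB : ∑ k, (B k)ᴴ * B k = 1)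
      (N : (k : Fin K) → ι → Matrix (α × Fin (d k)) (α × Fin (d k)) ℂ)
      (hN : ∀ k, IsLOCC α (Fin (d k)) (N k)) :
      IsLOCC α β (fun i => ∑ k,
        ((1 : Matrix α α ℂ) ⊗ₖ B k)ᴴ * N k i * ((1 : Matrix α α ℂ) ⊗ₖ B k))

/-- Average probability of identifying the state of the ensemble `{(p i, ρ i)}` correctly when the
measurement `M` is performed and its outcome is taken as the guess. -/
def avgSuccess (p : ι → ℝ) (ρ M : ι → Matrix α α ℂ) : ℝ :=
  ∑ i, p i * ((ρ i * M i).trace).re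

/-- The success probability (global optimum) of an ensemble. -/
def globalOpt (p : ι → ℝ) (ρ : ι → Matrix α α ℂ) : ℝ :=
  sSup {s | ∃ M : ι → Matrix α α ℂ, IsMeasurement M ∧ s = avgSuccess p ρ M}

/-- The local success probability (local optimum) of an ensemble of bipartite states. -/
def localOpt (p : ι → ℝ) (ρ : ι → Matrix (α × β) (α × β) ℂ) : ℝ :=
  sSup {s | ∃ M : ι → Matrix (α × β) (α × β) ℂ, IsLOCC α β M ∧ s = avgSuccess p ρ M}

/-- The state `ρ ⊗ |τ⟩⟨τ|` of a bipartite system `α : β` together with an ancilla `α' : β'` in the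
pure state `τ`, as a state of the bipartite system `(α × α') : (β × β')`. -/
def withResource (ρ : Matrix (α × β) (α × β) ℂ) (τ : α' × β' → ℂ) :
    Matrix ((α × α') × (β × β')) ((α × α') × (β × β')) ℂ :=
  Matrix.reindex (Equiv.prodProdProdComm α β α' β') (Equiv.prodProdProdComm α β α' β')
    (ρ ⊗ₖ ketbra τ)

/-- The entanglement entropy of a bipartite pure state, in ebits: the von Neumann entropy, with
logarithms to base 2, of its reduced state. -/
def entanglementEntropy (ψ : α × β → ℂ) : ℝ :=
  ∑ a, Real.negMulLog ((reducedState_isHermitian ψ).eigenvalues a) / Real.log 2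

/-- With the ancilla state `τ`, LOCC measurements reach the global optimum of the ensemble. -/
def EnablesOptimal (p : ι → ℝ) (ρ : ι → Matrix (α × β) (α × β) ℂ) (τ : α' × β' → ℂ) : Prop :=
  localOpt p (fun i => withResource (ρ i) τ) = globalOpt p ρ

/-- `τ ∈ ℂ^m ⊗ ℂ^n` is an optimal resource: it enables optimal discrimination by LOCC, and among
all bipartite pure states (of any finite dimension) that do so, it is minimal both in entanglement
and in dimension. -/
def IsOptimalResource (p : ι → ℝ) (ρ : ι → Matrix (α × β) (α × β) ℂ) {m n : ℕ}
    (τ : Fin m × Fin n → ℂ) : Prop :=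
  IsUnitVector τ ∧ EnablesOptimal p ρ τ ∧
    ∀ (m' n' : ℕ) (τ' : Fin m' × Fin n' → ℂ), IsUnitVector τ' → EnablesOptimal p ρ τ' →
      entanglementEntropy τ ≤ entanglementEntropy τ' ∧ m * n ≤ m' * n'

/-- The entanglement cost of discriminating the ensemble by LOCC is `c` ebits: there is an optimal
resource, and its entanglement is `c`. -/
def IsEntanglementCost (p : ι → ℝ) (ρ : ι → Matrix (α × β) (α × β) ℂ) (c : ℝ) : Prop :=
  ∃ (m n : ℕ) (τ : Fin m × Fin n → ℂ), IsOptimalResource p ρ τ ∧ entanglementEntropy τ = c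

/-- The entanglement cost does not depend on the choice of the optimal resource. -/
theorem IsEntanglementCost.unique {p : ι → ℝ} {ρ : ι → Matrix (α × β) (α × β) ℂ} {c c' : ℝ}
    (h : IsEntanglementCost p ρ c) (h' : IsEntanglementCost p ρ c') : c = c' := by
  obtain ⟨m, n, τ, ⟨h1, h2, h3⟩, rfl⟩ := h
  obtain ⟨m', n', τ', ⟨h1', h2', h3'⟩, rfl⟩ := h'
  exact le_antisymm (h3 _ _ τ' h1' h2').1 (h3' _ _ τ h1 h2).1

end General

/-- The two-qubit computational basis vector `|ab⟩`. -/
def ket (a b : Fin 2) : Fin 2 × Fin 2 → ℂ :=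
  Pi.single (a, b) 1

/-- The Bell states `|Ψ₁⟩, …, |Ψ₄⟩` (indexed from `0`). -/
def bell : Fin 4 → (Fin 2 × Fin 2 → ℂ) :=
  ![((1 / √2 : ℝ) : ℂ) • (ket 0 0 + ket 1 1),
    ((1 / √2 : ℝ) : ℂ) • (ket 0 0 - ket 1 1),
    ((1 / √2 : ℝ) : ℂ) • (ket 0 1 + ket 1 0),
    ((1 / √2 : ℝ) : ℂ) • (ket 0 1 - ket 1 0)]

/-- The noisy Bell states `ϱ i = l Ψ i + (1 - l) ς`. -/
def noisyBell (l : ℝ) (ς : Matrix (Fin 2 × Fin 2) (Fin 2 × Fin 2) ℂ) (i : Fin 4) :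
    Matrix (Fin 2 × Fin 2) (Fin 2 × Fin 2) ℂ :=
  (l : ℂ) • ketbra (bell i) + ((1 - l : ℝ) : ℂ) • ς

/-- The uniform distribution on four states. -/
def uniform4 : Fin 4 → ℝ := fun _ => 1 / 4

/-- The resource `|τ_ε⟩ = √((1+ε)/2) |00⟩ + √((1-ε)/2) |11⟩`. -/
def tau (ε : ℝ) : Fin 2 × Fin 2 → ℂ :=
  ((√((1 + ε) / 2) : ℝ) : ℂ) • ket 0 0 + ((√((1 - ε) / 2) : ℝ) : ℂ) • ket 1 1

end NoisyBell

end

open NoisyBell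

/-! The common noise changes every success probability by the same increasing affine map
(`avgSuccess_noisy`), so only the pure Bell states matter, and optimality means that the four
overlaps sum to 4.

The lower bound on the resource is a duality argument. LOCC operators have nonnegative expectation
in block-positive operators (`IsLOCC.trace_re_nonneg`). Write `τ = p ⊗ q + r`. For each `s ≥ 1` one
operator `H`, the same for all four states, makes every `H - |Ψᵢ ⊗ τ⟩⟨Ψᵢ ⊗ τ|` block positive
(`blockPositive_bell`), so the LOCC overlaps sum to at most `tr H`. If `‖r‖² < 1/2`, some `s > 1`
gives `tr H < 4`. Hence an enabling `τ` has squared distance at least 1/2 from every product vector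
(`EnablesOptimal.half_le`): its reduced state has no eigenvalue above 1/2, which forces one ebit and
both local dimensions at least 2.

Conversely, with a Bell pair Alice teleports her qubit and Bob measures in a rotated Bell basis
(`enablesOptimal_bell`). -/

namespace NoisyBell

open Matrix Finset

/-! ### Block positivity and LOCC measurements -/

/-- The product vector `u ⊗ v`. -/
def prodVec {α β : Type} (u : α → ℂ) (v : β → ℂ) : α × β → ℂ := fun x => u x.1 * v x.2

/-- The operator `D` is nonnegative on product vectors. -/
def BlockPositive {α β : Type} [Fintype α] [Fintype β] (D : Matrix (α × β) (α × β) ℂ) : Prop :=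
  ∀ u v, 0 ≤ (star (prodVec u v) ⬝ᵥ D *ᵥ prodVec u v).re

theorem kronecker_mulVec_prodVec {α β α' β' : Type} [Fintype α] [Fintype β]
    (A : Matrix α' α ℂ) (B : Matrix β' β ℂ) (u : α → ℂ) (v : β → ℂ) :
    (A ⊗ₖ B) *ᵥ prodVec u v = prodVec (A *ᵥ u) (B *ᵥ v) := by
  ext x
  simp only [mulVec, dotProduct, prodVec, Fintype.sum_prod_type, kroneckerMap_apply, sum_mul_sum]
  exact sum_congr rfl fun i _ => sum_congr rfl fun j _ => by ring

/-- The adjoint of a local operator sends product vectors to product vectors. This is the inductive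
step through a round of communication. -/
theorem BlockPositive.conj_kronecker {α β α' β' : Type} [Fintype α] [Fintype β]
    [Fintype α'] [Fintype β'] {D : Matrix (α × β) (α × β) ℂ} (hD : BlockPositive D)
    (A : Matrix α' α ℂ) (B : Matrix β' β ℂ) :
    BlockPositive ((A ⊗ₖ B) * D * (A ⊗ₖ B)ᴴ) := by
  intro u v
  have h := hD (Aᴴ *ᵥ u) (Bᴴ *ᵥ v)
  rw [← kronecker_mulVec_prodVec, ← conjTranspose_kronecker, star_mulVec,
    conjTranspose_conjTranspose, ← dotProduct_mulVec, mulVec_mulVec, mulVec_mulVec] at h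
  exact h

theorem BlockPositive.trace_re_nonneg {α β : Type} [Fintype α] [DecidableEq α] [Fintype β]
    [DecidableEq β] {D : Matrix (α × β) (α × β) ℂ} (hD : BlockPositive D) : 0 ≤ D.trace.re := by
  simp only [trace, diag_apply, Complex.re_sum]
  refine sum_nonneg fun x _ => ?_
  have h := hD (Pi.single x.1 1) (Pi.single x.2 1)
  have e : prodVec (Pi.single x.1 (1 : ℂ)) (Pi.single x.2 (1 : ℂ)) = Pi.single x 1 := by
    ext y
    simp only [prodVec, Pi.single_apply, Prod.ext_iff]
    split_ifs <;> simp_all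
  rw [e] at h
  simpa [← Pi.single_star] using h

/-- An LOCC measurement has nonnegative expectation in every block-positive operator. -/
theorem IsLOCC.trace_re_nonneg {ι : Type} [DecidableEq ι] {α β : Type} [Fintype α] [DecidableEq α]
    [Fintype β] [DecidableEq β] {M : ι → Matrix (α × β) (α × β) ℂ} (hM : IsLOCC α β M) (i : ι)
    {D : Matrix (α × β) (α × β) ℂ} (hD : BlockPositive D) : 0 ≤ (D * M i).trace.re := by
  have key : ∀ {γ δ : Type} [Fintype γ] [Fintype δ] (D : Matrix γ γ ℂ) (K : Matrix δ γ ℂ)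
      (N : Matrix δ δ ℂ), (D * (Kᴴ * N * K)).trace = (K * D * Kᴴ * N).trace := by
    intro γ δ _ _ D K N
    rw [← Matrix.mul_assoc, trace_mul_comm]
    simp only [Matrix.mul_assoc]
  induction hM with
  | guess j =>
    by_cases h : i = j
    · simpa [h] using hD.trace_re_nonneg
    · simp [h]
  -- Cyclicity of the trace moves the Kraus operators from the measurement onto `D`, which stays
  -- block positive.
  | alice K d A hA N hN ih =>
    simp only [Matrix.mul_sum, trace_sum, Complex.re_sum, key]
    exact sum_nonneg fun k _ => ih k (hD.conj_kronecker _ _)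
  | bob K d A hA N hN ih =>
    simp only [Matrix.mul_sum, trace_sum, Complex.re_sum, key]
    exact sum_nonneg fun k _ => ih k (hD.conj_kronecker _ _)

theorem IsLOCC.sum_eq_one {ι : Type} [Fintype ι] [DecidableEq ι] {α β : Type} [Fintype α]
    [DecidableEq α] [Fintype β] [DecidableEq β] {M : ι → Matrix (α × β) (α × β) ℂ}
    (hM : IsLOCC α β M) : ∑ i, M i = 1 := by
  induction hM with
  | guess j => simp
  | alice K d A hA N hN ih =>
    rw [sum_comm]
    simp only [← Matrix.mul_sum, ← Matrix.sum_mul, ih, Matrix.mul_one, conjTranspose_kronecker,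
      ← mul_kronecker_mul, conjTranspose_one]
    rw [← one_kronecker_one, ← hA]
    ext x y
    simp [Matrix.sum_apply, sum_mul]
  | bob K d A hA N hN ih =>
    rw [sum_comm]
    simp only [← Matrix.mul_sum, ← Matrix.sum_mul, ih, Matrix.mul_one, conjTranspose_kronecker,
      ← mul_kronecker_mul, conjTranspose_one]
    rw [← one_kronecker_one, ← hA]
    ext x y
    simp [Matrix.sum_apply, mul_sum]

/-! ### One-way protocols from tight frames -/

theorem ketbra_conjTranspose_mul_single_row {α : Type} (a : α → ℂ) {e : Type} [Fintype e]
    [Unique e] : (Matrix.of fun (_ : e) x => star (a x))ᴴ * (Matrix.of fun (_ : e) x => star (a x))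
      = ketbra a := by
  ext x y
  simp [Matrix.mul_apply, ketbra, vecMulVec_apply]

/-- Alice measures in the tight frame `a`, tells Bob the outcome `k`, and Bob measures in the tight
frame `b k`. -/
theorem isLOCC_oneWay {ι : Type} [DecidableEq ι] {α β : Type} [Fintype α] [DecidableEq α]
    [Fintype β] [DecidableEq β] {K L : ℕ} (a : Fin K → α → ℂ) (b : Fin K → Fin L → β → ℂ)
    (g : Fin L → ι) (ha : ∑ k, ketbra (a k) = 1) (hb : ∀ k, ∑ j, ketbra (b k j) = 1) :
    IsLOCC α β fun i => ∑ k, ∑ j, if i = g j then ketbra (prodVec (a k) (b k j)) else 0 := by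
  -- Each rank-one outcome has the row `⟨a k|` as Kraus operator, which leaves a one-dimensional
  -- system.
  have h := IsLOCC.alice (ι := ι) (α := α) (β := β) K (fun _ => 1)
    (fun k => Matrix.of fun (_ : Fin 1) x => star (a k x))
    (by simpa only [ketbra_conjTranspose_mul_single_row] using ha) _
    (fun k => IsLOCC.bob L (fun _ => 1) (fun j => Matrix.of fun (_ : Fin 1) x => star (b k j x))
      (by simpa only [ketbra_conjTranspose_mul_single_row] using hb k) _
      (fun j => IsLOCC.guess (g j)))
  convert h using 1
  ext1 i
  refine sum_congr rfl fun k _ => ?_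
  rw [Matrix.mul_sum, Matrix.sum_mul]
  refine sum_congr rfl fun j _ => ?_
  split_ifs
  · ext x y
    simp [Matrix.mul_apply, ketbra, prodVec, vecMulVec_apply, Fintype.sum_prod_type,
      Matrix.one_apply, apply_ite (starRingEnd ℂ)]
    ring
  · simp

/-! ### Pure states, resources and noise -/

theorem trace_ketbra_mul {α : Type} [Fintype α] (w : α → ℂ) (M : Matrix α α ℂ) :
    (ketbra w * M).trace = star w ⬝ᵥ M *ᵥ w := by
  rw [ketbra, trace_mul_comm, mul_vecMulVec, trace_vecMulVec, dotProduct_comm]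

theorem dotProduct_ketbra_mulVec {α : Type} [Fintype α] (w ψ : α → ℂ) :
    (star w ⬝ᵥ ketbra ψ *ᵥ w).re = ‖star w ⬝ᵥ ψ‖ ^ 2 := by
  rw [ketbra, vecMulVec_mulVec]
  have h : star ψ ⬝ᵥ w = star (star w ⬝ᵥ ψ) := by
    simp [dotProduct, mul_comm]
  rw [h, op_smul_eq_smul, dotProduct_smul, smul_eq_mul, mul_comm, ← Complex.normSq_eq_norm_sq,
    ← Complex.ofReal_re (Complex.normSq _), ← Complex.mul_conj]
  rfl

/-- The vector `ψ ⊗ τ`, arranged as a vector of the bipartite system `(α × α') : (β × β')`. -/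
def joint {α β α' β' : Type} (ψ : α × β → ℂ) (τ : α' × β' → ℂ) : (α × α') × (β × β') → ℂ :=
  fun x => ψ (x.1.1, x.2.1) * τ (x.1.2, x.2.2)

theorem withResource_ketbra {α β α' β' : Type} (ψ : α × β → ℂ) (τ : α' × β' → ℂ) :
    withResource (ketbra ψ) τ = ketbra (joint ψ τ) := by
  ext x y
  simp [withResource, ketbra, joint, vecMulVec_apply]
  ring

theorem withResource_noisyBell {α' β' : Type} (l : ℝ)
    (ς : Matrix (Fin 2 × Fin 2) (Fin 2 × Fin 2) ℂ) (τ : α' × β' → ℂ) (i : Fin 4) :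
    withResource (noisyBell l ς i) τ =
      (l : ℂ) • ketbra (joint (bell i) τ) + ((1 - l : ℝ) : ℂ) • withResource ς τ := by
  rw [← withResource_ketbra]
  ext x y
  simp [withResource, noisyBell]
  ring

theorem trace_ketbra {α : Type} [Fintype α] (ψ : α → ℂ) :
    (ketbra ψ).trace = ((∑ a, ‖ψ a‖ ^ 2 : ℝ) : ℂ) := by
  simp [trace, ketbra, vecMulVec_apply, Complex.mul_conj, Complex.normSq_eq_norm_sq]

theorem trace_withResource {α β α' β' : Type} [Fintype α] [Fintype β] [Fintype α'] [Fintype β']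
    (ρ : Matrix (α × β) (α × β) ℂ) (τ : α' × β' → ℂ) :
    (withResource ρ τ).trace = ρ.trace * (ketbra τ).trace := by
  rw [← trace_kronecker]
  simp only [withResource, trace, diag_apply, reindex_apply, submatrix_apply]
  exact Equiv.sum_comp (Equiv.prodProdProdComm α β α' β').symm
    fun x => (ρ ⊗ₖ ketbra τ) x x

/-- Admixing a fixed noise state to four equiprobable pure states changes the success probability of
every measurement in the same way. -/
theorem avgSuccess_noisy {γ : Type} [Fintype γ] [DecidableEq γ] (l : ℝ) (w : Fin 4 → γ → ℂ)
    {σ : Matrix γ γ ℂ} (hσ : σ.trace = 1) {M : Fin 4 → Matrix γ γ ℂ} (hM : ∑ i, M i = 1) :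
    avgSuccess uniform4 (fun i => (l : ℂ) • ketbra (w i) + ((1 - l : ℝ) : ℂ) • σ) M =
      l / 4 * ∑ i, (ketbra (w i) * M i).trace.re + (1 - l) / 4 := by
  have h : ∑ i, (σ * M i).trace.re = 1 := by
    rw [← Complex.re_sum, ← trace_sum, ← Matrix.mul_sum, hM, Matrix.mul_one, hσ, Complex.one_re]
  have h2 : ∀ i, (((l : ℂ) • ketbra (w i) + ((1 - l : ℝ) : ℂ) • σ) * M i).trace.re =
      l * (ketbra (w i) * M i).trace.re + (1 - l) * (σ * M i).trace.re := by
    intro i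
    rw [Matrix.add_mul, Matrix.smul_mul, Matrix.smul_mul, trace_add, trace_smul, trace_smul,
      Complex.add_re, smul_eq_mul, smul_eq_mul, Complex.re_ofReal_mul, Complex.re_ofReal_mul]
  simp only [avgSuccess, uniform4, h2, mul_add, sum_add_distrib]
  have h3 : (1 - l) / 4 = (1 - l) / 4 * ∑ i, (σ * M i).trace.re := by rw [h, mul_one]
  rw [h3, mul_sum, mul_sum]
  congr 1 <;> exact sum_congr rfl fun i _ => by ring

/-! ### Global optimum -/

theorem sum_normSq_bell (i : Fin 4) : ∑ a, ‖bell i a‖ ^ 2 = 1 := by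
  fin_cases i <;> simp [bell, ket, Fintype.sum_prod_type, Pi.single_apply] <;> norm_num

theorem sum_ketbra_bell : ∑ i, ketbra (bell i) = 1 := by
  have h : (((√2 : ℝ) : ℂ))⁻¹ * ((√2 : ℝ) : ℂ)⁻¹ = 1 / 2 := by
    rw [← mul_inv, ← Complex.ofReal_mul, Real.mul_self_sqrt zero_le_two]; norm_num
  ext ⟨x, y⟩ ⟨z, t⟩
  simp only [Fin.sum_univ_four, ketbra, vecMulVec_apply, Matrix.add_apply]
  fin_cases x <;> fin_cases y <;> fin_cases z <;> fin_cases t <;>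
    simp [bell, ket, h] <;> norm_num

/-- The Bell measurement identifies the pure parts perfectly, and no overlap can exceed 1 since `M i
≤ 1`. -/
theorem globalOpt_noisyBell {l : ℝ} (hl : 0 ≤ l) {ς : Matrix (Fin 2 × Fin 2) (Fin 2 × Fin 2) ℂ}
    (hς : IsDensityMatrix ς) : globalOpt uniform4 (noisyBell l ς) = l + (1 - l) / 4 := by
  refine IsGreatest.csSup_eq ⟨⟨fun i => ketbra (bell i), ⟨fun i => ?_, sum_ketbra_bell⟩, ?_⟩, ?_⟩
  · exact posSemidef_vecMulVec_self_star _
  · refine Eq.symm ((avgSuccess_noisy l bell hς.2 sum_ketbra_bell).trans ?_)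
    have h : ∀ i, (ketbra (bell i) * ketbra (bell i)).trace.re = 1 := by
      intro i
      rw [trace_ketbra_mul, dotProduct_ketbra_mulVec]
      have : star (bell i) ⬝ᵥ bell i = 1 := by
        have := trace_ketbra (bell i)
        rw [sum_normSq_bell, ketbra, trace_vecMulVec, dotProduct_comm] at this
        simpa using this
      simp [this]
    simp only [h]
    simp
  · rintro _ ⟨M, ⟨hM, hM1⟩, rfl⟩
    refine (avgSuccess_noisy l bell hς.2 hM1).trans_le ?_
    have h : ∀ i, (ketbra (bell i) * M i).trace.re ≤ 1 := by
      intro i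
      have h1 : (1 - M i).PosSemidef := by
        rw [← hM1, ← add_sum_erase _ _ (mem_univ i), add_sub_cancel_left]
        exact posSemidef_sum _ fun j _ => hM j
      have h2 := h1.re_dotProduct_nonneg (bell i)
      have h3 := congrArg Complex.re (trace_ketbra (bell i))
      rw [← Matrix.mul_one (ketbra (bell i)), trace_ketbra_mul, sum_normSq_bell] at h3
      rw [sub_mulVec, dotProduct_sub, map_sub] at h2
      rw [trace_ketbra_mul]
      simp at h2 h3 ⊢
      linarith
    have h4 : ∑ i, (ketbra (bell i) * M i).trace.re ≤ 4 := by
      refine (sum_le_sum fun i _ => h i).trans ?_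
      simp
    nlinarith

/-! ### Inequalities for two-by-two matrices -/

/-- The diagonal of a two-by-two matrix in the orthonormal basis `(c̄, d̄), (-d, c)` is bounded by its
Frobenius norm. -/
theorem norm_sq_diag_le {c d : ℂ} (h : ‖c‖ ^ 2 + ‖d‖ ^ 2 = 1) (y : Fin 2 → Fin 2 → ℂ) :
    ‖c * (y 0 0 * star c + y 0 1 * star d) + d * (y 1 0 * star c + y 1 1 * star d)‖ ^ 2 +
      ‖star c * (y 1 1 * c - y 1 0 * d) - star d * (y 0 1 * c - y 0 0 * d)‖ ^ 2 ≤
    ∑ a, ∑ b, ‖y a b‖ ^ 2 := by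
  -- Unitary invariance of the Frobenius norm: the four terms are the entries of `y` in the rotated
  -- basis.
  have key : ‖c * (y 0 0 * star c + y 0 1 * star d) + d * (y 1 0 * star c + y 1 1 * star d)‖ ^ 2 +
      ‖star c * (y 1 1 * c - y 1 0 * d) - star d * (y 0 1 * c - y 0 0 * d)‖ ^ 2 +
      ‖c * (y 0 1 * c - y 0 0 * d) + d * (y 1 1 * c - y 1 0 * d)‖ ^ 2 +
      ‖star c * (y 1 0 * star c + y 1 1 * star d) - star d * (y 0 0 * star c + y 0 1 * star d)‖ ^ 2
      = (‖c‖ ^ 2 + ‖d‖ ^ 2) ^ 2 * ∑ a, ∑ b, ‖y a b‖ ^ 2 := by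
    apply Complex.ofReal_injective
    simp only [← Complex.normSq_eq_norm_sq, Complex.ofReal_add, Complex.ofReal_mul,
      Complex.ofReal_pow, ← Complex.mul_conj, Fin.sum_univ_two, map_add,
      map_sub, map_mul, Complex.star_def, Complex.conj_conj]
    ring
  rw [h, one_pow, one_mul] at key
  linarith [sq_nonneg ‖c * (y 0 1 * c - y 0 0 * d) + d * (y 1 1 * c - y 1 0 * d)‖,
    sq_nonneg
      ‖star c * (y 1 0 * star c + y 1 1 * star d) - star d * (y 0 0 * star c + y 0 1 * star d)‖]

/-- The trace of a two-by-two matrix that is close to having rank one. -/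
theorem norm_trace_sq_le {s : ℝ} (hs : 1 ≤ s) (x y : Fin 2 → ℂ) (r : Fin 2 → Fin 2 → ℂ) :
    ‖(x 0 * y 0 + r 0 0) + (x 1 * y 1 + r 1 1)‖ ^ 2 ≤
      (1 + 1 / s) * ∑ a, ∑ b, ‖x a * y b + r a b‖ ^ 2 + (s - 1 / s) * ∑ a, ∑ b, ‖r a b‖ ^ 2 := by
  -- Rotate to a basis adapted to `y`; any unit vector serves when `y = 0`.
  obtain ⟨c, d, t, hcd, h0, h1⟩ : ∃ c d t : ℂ, ‖c‖ ^ 2 + ‖d‖ ^ 2 = 1 ∧ y 0 = t * c ∧ y 1 = t * d := by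
    by_cases h : ‖y 0‖ ^ 2 + ‖y 1‖ ^ 2 = 0
    · refine ⟨1, 0, 0, by simp, ?_, ?_⟩
      · have : ‖y 0‖ ^ 2 = 0 := by nlinarith [sq_nonneg ‖y 0‖, sq_nonneg ‖y 1‖]
        simpa using this
      · have : ‖y 1‖ ^ 2 = 0 := by nlinarith [sq_nonneg ‖y 0‖, sq_nonneg ‖y 1‖]
        simpa using this
    · have hn : 0 ≤ ‖y 0‖ ^ 2 + ‖y 1‖ ^ 2 := by positivity
      have h' : ((√(‖y 0‖ ^ 2 + ‖y 1‖ ^ 2) : ℝ) : ℂ) ≠ 0 := by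
        rw [Complex.ofReal_ne_zero, Real.sqrt_ne_zero hn]; exact h
      refine ⟨y 0 / (√(‖y 0‖ ^ 2 + ‖y 1‖ ^ 2) : ℝ), y 1 / (√(‖y 0‖ ^ 2 + ‖y 1‖ ^ 2) : ℝ),
        (√(‖y 0‖ ^ 2 + ‖y 1‖ ^ 2) : ℝ), ?_, ?_, ?_⟩
      · rw [norm_div, norm_div, div_pow, div_pow, Complex.norm_real, Real.norm_eq_abs, sq_abs,
          Real.sq_sqrt hn, ← add_div, div_self h]
      · field_simp
      · field_simp
  have hY := norm_sq_diag_le hcd fun a b => x a * y b + r a b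
  have hR := norm_sq_diag_le hcd r
  beta_reduce at hY
  set A := c * ((x 0 * y 0 + r 0 0) * star c + (x 0 * y 1 + r 0 1) * star d) +
    d * ((x 1 * y 0 + r 1 0) * star c + (x 1 * y 1 + r 1 1) * star d) with hA
  set B := star c * (r 1 1 * c - r 1 0 * d) - star d * (r 0 1 * c - r 0 0 * d) with hB
  -- The rank-one part vanishes in the second diagonal entry, since `(c, d)` pairs to zero with
  -- `(-d, c)`. So `B` sees only `r`.
  have e1 : star c * ((x 1 * y 1 + r 1 1) * c - (x 1 * y 0 + r 1 0) * d) -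
      star d * ((x 0 * y 1 + r 0 1) * c - (x 0 * y 0 + r 0 0) * d) = B := by
    rw [h0, h1]; ring
  have hcd' : c * star c + d * star d = 1 := by
    rw [Complex.star_def, Complex.mul_conj, Complex.mul_conj, Complex.normSq_eq_norm_sq,
      Complex.normSq_eq_norm_sq, ← Complex.ofReal_add, hcd, Complex.ofReal_one]
  have e2 : (x 0 * y 0 + r 0 0) + (x 1 * y 1 + r 1 1) = A + B := by
    rw [← e1]
    linear_combination (-(x 0 * y 0 + r 0 0) - (x 1 * y 1 + r 1 1)) * hcd'
  rw [e1] at hY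
  rw [e2]
  have hs0 : 0 < s := by linarith
  have hs1 : 0 ≤ s - 1 / s := by
    have : 1 / s ≤ 1 := by rw [div_le_one hs0]; exact hs
    linarith
  have hBR : ‖B‖ ^ 2 ≤ ∑ a, ∑ b, ‖r a b‖ ^ 2 := by
    linarith [sq_nonneg ‖c * (r 0 0 * star c + r 0 1 * star d) +
      d * (r 1 0 * star c + r 1 1 * star d)‖]
  calc ‖A + B‖ ^ 2 ≤ (‖A‖ + ‖B‖) ^ 2 := by gcongr; exact norm_add_le _ _
    _ ≤ (1 + 1 / s) * (‖A‖ ^ 2 + ‖B‖ ^ 2) + (s - 1 / s) * ‖B‖ ^ 2 := by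
      have : (1 + 1 / s) * (‖A‖ ^ 2 + ‖B‖ ^ 2) + (s - 1 / s) * ‖B‖ ^ 2 - (‖A‖ + ‖B‖) ^ 2 =
          (‖A‖ - s * ‖B‖) ^ 2 / s := by field_simp; ring
      have h2 : 0 ≤ (‖A‖ - s * ‖B‖) ^ 2 / s := by positivity
      linarith
    _ ≤ _ := by gcongr

/-- The overlap of a Bell state with a two-qubit vector that is close to a product vector. -/
theorem norm_bell_sq_le {s : ℝ} (hs : 1 ≤ s) (i : Fin 4) (x y : Fin 2 → ℂ)
    (r : Fin 2 → Fin 2 → ℂ) :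
    ‖∑ a, ∑ b, bell i (a, b) * (x a * y b + r a b)‖ ^ 2 ≤
      (1 + 1 / s) / 2 * ∑ a, ∑ b, ‖x a * y b + r a b‖ ^ 2 +
        (s - 1 / s) / 2 * ∑ a, ∑ b, ‖r a b‖ ^ 2 := by
  have hc : ∀ z : ℂ, ‖1 / ((√2 : ℝ) : ℂ) * z‖ ^ 2 = ‖z‖ ^ 2 / 2 := by
    intro z
    rw [one_div, norm_mul, mul_pow, norm_inv, Complex.norm_real, Real.norm_eq_abs, inv_pow, sq_abs,
      Real.sq_sqrt zero_le_two]
    ring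
  have hn : ∀ z w u : ℂ, ‖-(z * w) + -u‖ = ‖z * w + u‖ := fun z w u => by
    rw [← neg_add, norm_neg]
  -- Up to the factor `1/√2`, each overlap is a trace after permuting and signing the rows.
  fin_cases i
  · have h := norm_trace_sq_le hs x y r
    simp [bell, ket, Pi.single_apply, Fin.sum_univ_two, -one_div] at h ⊢
    rw [← mul_add, hc]
    linarith
  · have h := norm_trace_sq_le hs ![x 0, -x 1] y ![r 0, -r 1]
    simp [bell, ket, Pi.single_apply, Fin.sum_univ_two, -one_div, hn] at h ⊢
    rw [← mul_neg, ← mul_add, hc, neg_add]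
    linarith
  · have h := norm_trace_sq_le hs ![x 1, x 0] y ![r 1, r 0]
    simp [bell, ket, Pi.single_apply, Fin.sum_univ_two, -one_div] at h ⊢
    rw [← mul_add, hc, add_comm (_ + r 0 1)]
    linarith
  · have h := norm_trace_sq_le hs ![-x 1, x 0] y ![-r 1, r 0]
    simp [bell, ket, Pi.single_apply, Fin.sum_univ_two, -one_div, hn] at h ⊢
    rw [← mul_neg, ← mul_add, hc, neg_add, add_comm (_ + r 0 1)]
    linarith

/-! ### The dual bound for a resource near a product vector -/

/-- The operator `1 ⊗ |τ⟩⟨τ|` on two qubits with an ancilla. -/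
def resourceOp {α' β' : Type} (τ : α' × β' → ℂ) :
    Matrix ((Fin 2 × α') × (Fin 2 × β')) ((Fin 2 × α') × (Fin 2 × β')) ℂ :=
  ∑ a : Fin 2, ∑ b : Fin 2, ketbra (joint (ket a b) τ)

theorem trace_resourceOp {α' β' : Type} [Fintype α'] [Fintype β'] (τ : α' × β' → ℂ) :
    (resourceOp τ).trace = ((4 * ∑ x, ‖τ x‖ ^ 2 : ℝ) : ℂ) := by
  have h : ∀ a b, (ketbra (ket a b)).trace = 1 := by
    intro a b
    simp [ket, ketbra]
  simp only [resourceOp, trace_sum, ← withResource_ketbra, trace_withResource, h, trace_ketbra τ]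
  simp
  ring

theorem dotProduct_resourceOp {α' β' : Type} [Fintype α'] [Fintype β'] (τ : α' × β' → ℂ)
    (w : (Fin 2 × α') × (Fin 2 × β') → ℂ) :
    (star w ⬝ᵥ resourceOp τ *ᵥ w).re = ∑ a, ∑ b, ‖star w ⬝ᵥ joint (ket a b) τ‖ ^ 2 := by
  simp only [resourceOp, sum_mulVec, dotProduct_sum, Complex.re_sum, dotProduct_ketbra_mulVec]

theorem joint_eq_sum {α' β' : Type} (ψ : Fin 2 × Fin 2 → ℂ) (τ : α' × β' → ℂ) :
    joint ψ τ = ∑ a, ∑ b, ψ (a, b) • joint (ket a b) τ := by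
  ext ⟨⟨a, a'⟩, ⟨b, b'⟩⟩
  fin_cases a <;> fin_cases b <;> simp [joint, ket]

theorem joint_add {α β α' β' : Type} (ψ : α × β → ℂ) (τ τ' : α' × β' → ℂ) :
    joint ψ (τ + τ') = joint ψ τ + joint ψ τ' := by
  ext x
  simp [joint, mul_add]

/-- Against a product test vector, a product resource leaves a rank-one two-by-two coefficient
matrix. -/
theorem prodVec_dotProduct_joint {α' β' : Type} [Fintype α'] [Fintype β'] (u : Fin 2 × α' → ℂ)
    (v : Fin 2 × β' → ℂ) (p : α' → ℂ) (q : β' → ℂ) (a b : Fin 2) :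
    star (prodVec u v) ⬝ᵥ joint (ket a b) (prodVec p q) =
      (∑ a', star (u (a, a')) * p a') * ∑ b', star (v (b, b')) * q b' := by
  have h : ∀ x y : Fin 2, ket a b (x, y) = (if x = a then 1 else 0) * if y = b then 1 else 0 := by
    intro x y
    simp only [ket, Pi.single_apply, Prod.mk.injEq]
    split_ifs <;> simp_all
  have h2 : ∀ x a' y b', star (u (x, a') * v (y, b')) * (((if x = a then 1 else 0) *
      if y = b then 1 else 0) * (p a' * q b')) =
      (if x = a then star (u (x, a')) * p a' else 0) *
        if y = b then star (v (y, b')) * q b' else 0 := by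
    intro x a' y b'
    split_ifs <;> simp
    ring
  simp only [dotProduct, Pi.star_apply, prodVec, joint, h, Fintype.sum_prod_type, h2]
  simp only [← mul_sum, ← sum_mul, sum_ite_irrel, sum_const_zero, sum_ite_eq', mem_univ, if_true]

theorem blockPositive_bell {α' β' : Type} [Fintype α'] [Fintype β'] {s : ℝ} (hs : 1 ≤ s) (i : Fin 4)
    (p : α' → ℂ) (q : β' → ℂ) (r : α' × β' → ℂ) :
    BlockPositive ((((1 + 1 / s) / 2 : ℝ) : ℂ) • resourceOp (prodVec p q + r) +
      (((s - 1 / s) / 2 : ℝ) : ℂ) • resourceOp r - ketbra (joint (bell i) (prodVec p q + r))) := by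
  intro u v
  have h := norm_bell_sq_le hs i (fun a => ∑ a', star (u (a, a')) * p a')
    (fun b => ∑ b', star (v (b, b')) * q b')
    fun a b => star (prodVec u v) ⬝ᵥ joint (ket a b) r
  simp only [← prodVec_dotProduct_joint, ← dotProduct_add, ← joint_add] at h
  rw [sub_mulVec, add_mulVec, smul_mulVec, smul_mulVec, dotProduct_sub, dotProduct_add,
    dotProduct_smul, dotProduct_smul, Complex.sub_re, Complex.add_re, smul_eq_mul, smul_eq_mul,
    Complex.re_ofReal_mul, Complex.re_ofReal_mul, dotProduct_resourceOp, dotProduct_resourceOp,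
    dotProduct_ketbra_mulVec, joint_eq_sum (bell i)]
  simp only [dotProduct_sum, dotProduct_smul, smul_eq_mul]
  linarith

/-- The Bell states with a resource that is `r`-close to a product vector are hard to discriminate
by LOCC. -/
theorem IsLOCC.sum_bell_le {α' β' : Type} [Fintype α'] [DecidableEq α'] [Fintype β']
    [DecidableEq β'] {M : Fin 4 → Matrix ((Fin 2 × α') × (Fin 2 × β')) _ ℂ}
    (hM : IsLOCC (Fin 2 × α') (Fin 2 × β') M) {s : ℝ} (hs : 1 ≤ s)
    (p : α' → ℂ) (q : β' → ℂ) (r : α' × β' → ℂ) :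
    ∑ i, (ketbra (joint (bell i) (prodVec p q + r)) * M i).trace.re ≤
      2 * (1 + 1 / s) * ∑ x, ‖(prodVec p q + r) x‖ ^ 2 + 2 * (s - 1 / s) * ∑ x, ‖r x‖ ^ 2 := by
  have h := sum_nonneg fun i (_ : i ∈ univ) => hM.trace_re_nonneg i (blockPositive_bell hs i p q r)
  simp only [sub_mul, trace_sub, Complex.sub_re, sum_sub_distrib] at h
  rw [← Complex.re_sum, ← trace_sum, ← Matrix.mul_sum, hM.sum_eq_one, Matrix.mul_one, trace_add,
    trace_smul, trace_smul, trace_resourceOp, trace_resourceOp, Complex.add_re, smul_eq_mul,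
    smul_eq_mul, Complex.re_ofReal_mul, Complex.re_ofReal_mul, Complex.ofReal_re,
    Complex.ofReal_re] at h
  linarith

theorem IsLOCC.avgSuccess_withResource {α' β' : Type} [Fintype α'] [DecidableEq α'] [Fintype β']
    [DecidableEq β'] {M : Fin 4 → Matrix ((Fin 2 × α') × (Fin 2 × β')) _ ℂ}
    (hM : IsLOCC (Fin 2 × α') (Fin 2 × β') M) (l : ℝ)
    {ς : Matrix (Fin 2 × Fin 2) (Fin 2 × Fin 2) ℂ} (hς : IsDensityMatrix ς) {τ : α' × β' → ℂ}
    (hτ : IsUnitVector τ) :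
    avgSuccess uniform4 (fun i => withResource (noisyBell l ς i) τ) M =
      l / 4 * ∑ i, (ketbra (joint (bell i) τ) * M i).trace.re + (1 - l) / 4 := by
  simp only [withResource_noisyBell]
  refine avgSuccess_noisy l _ ?_ hM.sum_eq_one
  rw [trace_withResource, hς.2, trace_ketbra, hτ]
  simp

/-- A resource that enables optimal discrimination is far from all product vectors. -/
theorem EnablesOptimal.half_le {α' β' : Type} [Fintype α'] [DecidableEq α'] [Fintype β']
    [DecidableEq β'] {l : ℝ} (hl : 0 < l) {ς : Matrix (Fin 2 × Fin 2) (Fin 2 × Fin 2) ℂ}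
    (hς : IsDensityMatrix ς) {τ : α' × β' → ℂ} (hτ : IsUnitVector τ)
    (h : EnablesOptimal uniform4 (noisyBell l ς) τ) (p : α' → ℂ) (q : β' → ℂ) :
    1 / 2 ≤ ∑ x, ‖(τ - prodVec p q) x‖ ^ 2 := by
  by_contra! hlt
  set R := ∑ x, ‖(τ - prodVec p q) x‖ ^ 2 with hR
  have hR0 : 0 ≤ R := sum_nonneg fun x _ => by positivity
  -- `s > 1` with `(s + 1) * R < 1`
  have hs : 1 ≤ 1 + (1 / 2 - R) := by linarith
  set s := 1 + (1 / 2 - R) with hs_def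
  have hs0 : 0 < s := by linarith
  have hbound : 2 * (1 + 1 / s) + 2 * (s - 1 / s) * R < 4 := by
    have e : 2 * (1 + 1 / s) + 2 * (s - 1 / s) * R - 4 = 2 * (s - 1) * ((s + 1) * R - 1) / s := by
      field_simp
      ring
    have : 2 * (s - 1) * ((s + 1) * R - 1) / s < 0 := by
      apply div_neg_of_neg_of_pos _ hs0
      apply mul_neg_of_pos_of_neg
      · linarith
      -- Here `1 - (s + 1) * R = (1/2 - R) * (2 - R)`.
      · nlinarith
    linarith
  have hle : localOpt uniform4 (fun i => withResource (noisyBell l ς i) τ) ≤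
      l / 4 * (2 * (1 + 1 / s) + 2 * (s - 1 / s) * R) + (1 - l) / 4 := by
    refine csSup_le ⟨_, _, IsLOCC.guess 0, rfl⟩ ?_
    rintro _ ⟨M, hM, rfl⟩
    rw [hM.avgSuccess_withResource l hς hτ]
    have h1 := hM.sum_bell_le hs p q (τ - prodVec p q)
    rw [add_sub_cancel, hτ, mul_one] at h1
    gcongr
  rw [h, globalOpt_noisyBell hl.le hς] at hle
  nlinarith

/-! ### Distance to product vectors and entropy -/

theorem trace_reducedState {α β : Type} [Fintype α] [Fintype β] {ψ : α × β → ℂ}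
    (hψ : IsUnitVector ψ) : (reducedState ψ).trace = 1 := by
  have h : (reducedState ψ).trace = (ketbra ψ).trace := by
    simp [trace, reducedState, ketbra, vecMulVec_apply, Fintype.sum_prod_type]
  rw [h, trace_ketbra, hψ, Complex.ofReal_one]

theorem reducedState_eq_mul {α β : Type} [Fintype β] (ψ : α × β → ℂ) :
    reducedState ψ = Matrix.of (fun a b => ψ (a, b)) * (Matrix.of fun a b => ψ (a, b))ᴴ := by
  ext a a'
  simp [reducedState, Matrix.mul_apply]

/-- The squared distance from `ψ` to its projection on the vectors of the form `e ⊗ q`. -/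
theorem sum_norm_sub_prodVec {α β : Type} [Fintype α] [Fintype β] (ψ : α × β → ℂ)
    (hψ : IsUnitVector ψ) (e : α → ℂ) (he : star e ⬝ᵥ e = 1) :
    ∑ x, ‖(ψ - prodVec e fun b => ∑ a, star (e a) * ψ (a, b)) x‖ ^ 2 =
      1 - (star e ⬝ᵥ reducedState ψ *ᵥ e).re := by
  set q : β → ℂ := fun b => ∑ a, star (e a) * ψ (a, b) with hq
  have h1 : (star e ⬝ᵥ reducedState ψ *ᵥ e) = ∑ b, q b * star (q b) := by
    have h0 : (Matrix.of fun a b => ψ (a, b))ᴴ *ᵥ e = star q := by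
      have : q = star e ᵥ* Matrix.of fun a b => ψ (a, b) := rfl
      rw [this, star_vecMul, star_star]
    rw [reducedState_eq_mul, ← mulVec_mulVec, dotProduct_mulVec, h0]
    rfl
  have h2 : ∑ x, ψ x * star (ψ x) = 1 := by
    have := trace_ketbra ψ
    rw [hψ] at this
    simpa [trace, ketbra, vecMulVec_apply] using this
  -- As for any orthogonal projection, both cross terms and the squared norm of `e ⊗ q` equal
  -- `‖q‖²`.
  have h3 : ∑ x : α × β, ψ x * star (e x.1 * q x.2) = ∑ b, q b * star (q b) := by
    rw [Fintype.sum_prod_type, sum_comm]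
    refine sum_congr rfl fun b _ => ?_
    rw [hq]
    simp only [sum_mul]
    refine sum_congr rfl fun a _ => ?_
    simp only [star_mul']
    ring
  have h4 : ∑ x : α × β, (e x.1 * q x.2) * star (e x.1 * q x.2) = ∑ b, q b * star (q b) := by
    rw [Fintype.sum_prod_type, sum_comm]
    refine sum_congr rfl fun b _ => ?_
    rw [← one_mul (q b * star (q b)), ← he, dotProduct, sum_mul]
    refine sum_congr rfl fun a _ => ?_
    simp only [star_mul', Pi.star_apply]
    ring
  have h5 : ∑ x : α × β, (e x.1 * q x.2) * star (ψ x) = ∑ b, q b * star (q b) := by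
    have := congrArg star h3
    simp only [star_sum, star_mul', star_star] at this
    rw [← (sum_congr rfl fun b _ => mul_comm _ _ : ∑ b, star (q b) * q b = ∑ b, q b * star (q b)),
      ← this]
    exact sum_congr rfl fun x _ => by ring
  apply Complex.ofReal_injective
  rw [← trace_ketbra]
  have h6 : (ketbra (ψ - prodVec e q)).trace = 1 - star e ⬝ᵥ reducedState ψ *ᵥ e := by
    have : (ketbra (ψ - prodVec e q)).trace = ∑ x, ψ x * star (ψ x) -
        ∑ x : α × β, ψ x * star (e x.1 * q x.2) - ∑ x : α × β, (e x.1 * q x.2) * star (ψ x) +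
        ∑ x : α × β, (e x.1 * q x.2) * star (e x.1 * q x.2) := by
      rw [← sum_sub_distrib, ← sum_sub_distrib, ← sum_add_distrib]
      simp only [trace, ketbra, diag_apply, vecMulVec_apply, Pi.sub_apply, Pi.star_apply, prodVec,
        star_sub]
      exact sum_congr rfl fun x _ => by ring
    rw [this, h2, h3, h4, h5, h1]
    ring
  rw [h6]
  have h8 : ((1 - star e ⬝ᵥ reducedState ψ *ᵥ e).im) = 0 := by
    rw [← h6, trace_ketbra, Complex.ofReal_im]
  apply Complex.ext
  · simp
  · rw [h8, Complex.ofReal_im]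

/-- A pure state whose reduced state has no eigenvalue above one half carries at least one ebit. -/
theorem one_le_entanglementEntropy {α β : Type} [Fintype α] [DecidableEq α] [Fintype β]
    [DecidableEq β] {ψ : α × β → ℂ} (hψ : IsUnitVector ψ)
    (h : ∀ e : α → ℂ, star e ⬝ᵥ e = 1 → (star e ⬝ᵥ reducedState ψ *ᵥ e).re ≤ 1 / 2) :
    1 ≤ entanglementEntropy ψ := by
  have hH := reducedState_isHermitian ψ
  have hle : ∀ a, hH.eigenvalues a ≤ 1 / 2 := by
    intro a
    rw [hH.eigenvalues_eq]
    apply h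
    have h1 := hH.eigenvectorBasis.inner_eq_one a
    rwa [EuclideanSpace.inner_eq_star_dotProduct, dotProduct_comm] at h1
  have hpos : ∀ a, 0 ≤ hH.eigenvalues a := by
    refine PosSemidef.eigenvalues_nonneg (A := reducedState ψ) ?_
    rw [reducedState_eq_mul]
    exact posSemidef_self_mul_conjTranspose _
  have hsum : ∑ a, hH.eigenvalues a = 1 := by
    have := hH.trace_eq_sum_eigenvalues
    rw [trace_reducedState hψ] at this
    apply Complex.ofReal_injective
    rw [Complex.ofReal_sum, Complex.ofReal_one, this]
    rfl
  -- Termwise comparison suffices: an eigenvalue `0 < x ≤ 1/2` satisfies `-x log x ≥ x log 2`.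
  rw [← hsum]
  refine sum_le_sum fun a _ => ?_
  rw [le_div_iff₀ (Real.log_pos one_lt_two)]
  rcases (hpos a).eq_or_lt with h0 | h0
  · rw [← h0]; simp
  · have : Real.log (hH.eigenvalues a) ≤ - Real.log 2 := by
      rw [← Real.log_inv]
      exact Real.log_le_log h0 (by simpa using hle a)
    rw [Real.negMulLog]
    nlinarith

/-! ### The teleportation protocol -/

/-- The Bell state `bell i`, up to normalization, as an integer matrix. -/
def bellSign : Fin 4 → Fin 2 → Fin 2 → ℤ :=
  ![![![1, 0], ![0, 1]], ![![1, 0], ![0, -1]], ![![0, 1], ![1, 0]], ![![0, 1], ![-1, 0]]]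

theorem bell_apply (i : Fin 4) (a b : Fin 2) :
    bell i (a, b) = ((1 / √2 : ℝ) : ℂ) * (bellSign i a b : ℂ) := by
  fin_cases i <;> fin_cases a <;> fin_cases b <;> simp [bell, ket, bellSign]

theorem ofReal_inv_sqrt_two_mul_self :
    ((1 / √2 : ℝ) : ℂ) * ((1 / √2 : ℝ) : ℂ) = 1 / 2 := by
  rw [← Complex.ofReal_mul, div_mul_div_comm, Real.mul_self_sqrt zero_le_two]
  norm_num

/-- The integer matrix of Bob's state when Alice finds `bell k` on her qubit of `bell i` and her
qubit of the resource `bell 0`. -/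
def bobSign (k i : Fin 4) (x : Fin 2 × Fin 2) : ℤ :=
  ∑ a, bellSign i a x.1 * bellSign k a x.2

/-- Bob's state when Alice finds `bell k` on her qubit of `bell i` and her qubit of the resource
`bell 0`. -/
noncomputable def bobVec (k i : Fin 4) (x : Fin 2 × Fin 2) : ℂ :=
  ((1 / √2 : ℝ) : ℂ) * (bobSign k i x : ℂ)

theorem sum_ketbra_bobVec (k : Fin 4) : ∑ i, ketbra (bobVec k i) = 1 := by
  have h : ∀ k x y, ∑ i, bobSign k i x * bobSign k i y = if x = y then 2 else 0 := by decide
  ext x y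
  have h' : ((∑ i, bobSign k i x * bobSign k i y : ℤ) : ℂ) = ((if x = y then 2 else 0 : ℤ) : ℂ) := by
    rw [h]
  push_cast at h'
  have e : ∀ i, ketbra (bobVec k i) x y = 1 / 2 * ((bobSign k i x : ℂ) * (bobSign k i y : ℂ)) := by
    intro i
    rw [← ofReal_inv_sqrt_two_mul_self, ketbra, vecMulVec_apply, Pi.star_apply, bobVec, bobVec,
      star_mul', Complex.star_def, Complex.conj_ofReal, map_intCast]
    ring
  rw [Matrix.sum_apply]
  simp only [e]
  rw [← mul_sum, h', Matrix.one_apply]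
  split_ifs <;> norm_num

/-- The amplitude 1/2 does not depend on `k` or `i`: each of Alice's four outcomes contributes
probability 1/4 of a correct guess, hence certainty in total. -/
theorem dotProduct_joint_bell (k i : Fin 4) :
    star (prodVec (bell k) (bobVec k i)) ⬝ᵥ joint (bell i) (bell 0) = 1 / 2 := by
  have h : ∀ k i, ∑ x : (Fin 2 × Fin 2) × (Fin 2 × Fin 2),
      bellSign k x.1.1 x.1.2 * bobSign k i x.2 *
        (bellSign i x.1.1 x.2.1 * bellSign 0 x.1.2 x.2.2) = 2 := by decide
  have h' := congrArg (Int.cast : ℤ → ℂ) (h k i)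
  push_cast at h'
  have e : ∀ x, star (prodVec (bell k) (bobVec k i)) x * joint (bell i) (bell 0) x =
      1 / 2 * (1 / 2) * (bellSign k x.1.1 x.1.2 * bobSign k i x.2 *
        (bellSign i x.1.1 x.2.1 * bellSign 0 x.1.2 x.2.2)) := by
    rintro ⟨⟨a, a'⟩, b⟩
    rw [← ofReal_inv_sqrt_two_mul_self, Pi.star_apply, prodVec, joint, bell_apply, bell_apply,
      bell_apply, bobVec, star_mul', star_mul', star_mul', Complex.star_def, Complex.conj_ofReal,
      map_intCast, map_intCast]
    ring
  rw [dotProduct, sum_congr rfl fun x _ => e x, ← mul_sum, h']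
  norm_num

theorem enablesOptimal_bell {l : ℝ} (hl : 0 < l) {ς : Matrix (Fin 2 × Fin 2) (Fin 2 × Fin 2) ℂ}
    (hς : IsDensityMatrix ς) : EnablesOptimal uniform4 (noisyBell l ς) (bell 0) := by
  have hu : IsUnitVector (bell 0) := sum_normSq_bell 0
  rw [EnablesOptimal, globalOpt_noisyBell hl.le hς]
  have hM := isLOCC_oneWay bell bobVec id sum_ketbra_bell sum_ketbra_bobVec
  refine IsGreatest.csSup_eq ⟨⟨_, hM, ?_⟩, ?_⟩
  · rw [hM.avgSuccess_withResource l hς hu]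
    have h : ∀ i, (ketbra (joint (bell i) (bell 0)) * ∑ k, ∑ j, if i = id j then
        ketbra (prodVec (bell k) (bobVec k j)) else 0).trace.re = 1 := by
      intro i
      simp only [id_eq, sum_ite_eq, mem_univ, if_true]
      rw [trace_mul_comm, Matrix.sum_mul, trace_sum, Complex.re_sum]
      simp only [trace_ketbra_mul, dotProduct_ketbra_mulVec, dotProduct_joint_bell]
      norm_num
    simp only [h]
    simp
  · rintro _ ⟨M, hM, rfl⟩
    rw [hM.avgSuccess_withResource l hς hu]
    -- At `s = 1` the coefficient of `‖r‖²` vanishes, so the zero product vector already gives the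
    -- bound 4.
    have h := hM.sum_bell_le le_rfl 0 0 (bell 0)
    have h0 : prodVec (0 : Fin 2 → ℂ) (0 : Fin 2 → ℂ) + bell 0 = bell 0 := by
      ext x
      simp [prodVec]
    rw [h0, hu] at h
    norm_num at h
    nlinarith

/-! ### Optimality of the Bell resource -/

theorem tau_zero : tau 0 = bell 0 := by
  have h : √((1 : ℝ) / 2) = 1 / √2 := by rw [Real.sqrt_div zero_le_one, Real.sqrt_one]
  simp only [tau, bell, add_zero, sub_zero, h, smul_add]
  rfl

theorem isUnitVector_tau {ε : ℝ} (hε : ε ∈ Set.Icc (0 : ℝ) 1) : IsUnitVector (tau ε) := by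
  have h1 : 0 ≤ (1 + ε) / 2 := by linarith [hε.1]
  have h2 : 0 ≤ (1 - ε) / 2 := by linarith [hε.2]
  simp [IsUnitVector, tau, ket, Fintype.sum_prod_type, -Nat.ofNat_nonneg, -Real.sqrt_div']
  rw [Real.sq_sqrt h1, Real.sq_sqrt h2]
  ring

theorem entanglementEntropy_bell : entanglementEntropy (bell 0) = 1 := by
  have h0 : reducedState (bell 0) = ((1 / 2 : ℝ) : ℂ) • 1 := by
    ext a b
    simp only [reducedState, of_apply, bell_apply, Fin.sum_univ_two, star_mul', Complex.star_def,
      Complex.conj_ofReal, map_intCast]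
    have := ofReal_inv_sqrt_two_mul_self
    fin_cases a <;> fin_cases b <;> simp [bellSign] at this ⊢ <;> exact this
  have hH := reducedState_isHermitian (bell 0)
  have h : ∀ a, hH.eigenvalues a = 1 / 2 := by
    intro a
    have h3 : ∀ v, reducedState (bell 0) *ᵥ v = ((1 / 2 : ℝ) : ℂ) • v := fun v => by
      rw [h0, smul_mulVec, one_mulVec]
    rw [hH.eigenvalues_eq, h3, dotProduct_smul]
    have h1 := hH.eigenvectorBasis.inner_eq_one a
    rw [EuclideanSpace.inner_eq_star_dotProduct, dotProduct_comm] at h1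
    rw [h1]
    simp
  have h2 : Real.log 2 ≠ 0 := (Real.log_pos one_lt_two).ne'
  simp only [entanglementEntropy, h, Real.negMulLog, one_div, Real.log_inv, Fin.sum_univ_two]
  field_simp
  norm_num

theorem EnablesOptimal.eq_zero_of_tau {l : ℝ} (hl : 0 < l)
    {ς : Matrix (Fin 2 × Fin 2) (Fin 2 × Fin 2) ℂ} (hς : IsDensityMatrix ς) {ε : ℝ}
    (hε : ε ∈ Set.Icc (0 : ℝ) 1) (h : EnablesOptimal uniform4 (noisyBell l ς) (tau ε)) : ε = 0 := by
  -- Removing the larger Schmidt term leaves squared distance `(1 - ε) / 2`, which is at least 1/2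
  -- only if `ε ≤ 0`.
  have h1 := h.half_le hl hς (isUnitVector_tau hε) (Pi.single 0 1)
    (Pi.single 0 (√((1 + ε) / 2) : ℝ))
  have h2 : 0 ≤ (1 - ε) / 2 := by linarith [hε.2]
  simp [tau, ket, prodVec, Fintype.sum_prod_type, -Real.sqrt_div'] at h1
  rw [Real.sq_sqrt h2] at h1
  exact le_antisymm (by linarith) hε.1

theorem EnablesOptimal.two_le {l : ℝ} (hl : 0 < l)
    {ς : Matrix (Fin 2 × Fin 2) (Fin 2 × Fin 2) ℂ} (hς : IsDensityMatrix ς) {m n : ℕ}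
    {τ : Fin m × Fin n → ℂ} (hτ : IsUnitVector τ)
    (h : EnablesOptimal uniform4 (noisyBell l ς) τ) : 2 ≤ m ∧ 2 ≤ n := by
  constructor
  · match m, τ, hτ, h with
    | 0, τ, hτ, h => simp [IsUnitVector] at hτ
    -- With a one-dimensional side, `τ` is itself a product vector, at distance zero.
    | 1, τ, hτ, h =>
      have h1 := h.half_le hl hς hτ 1 fun b => τ (0, b)
      norm_num [prodVec, Fintype.sum_prod_type] at h1
    | m + 2, τ, hτ, h => omega
  · match n, τ, hτ, h with
    | 0, τ, hτ, h => simp [IsUnitVector] at hτ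
    | 1, τ, hτ, h =>
      have h1 := h.half_le hl hς hτ (fun a => τ (a, 0)) 1
      norm_num [prodVec, Fintype.sum_prod_type] at h1
    | n + 2, τ, hτ, h => omega

theorem isOptimalResource_bell {l : ℝ} (hl : 0 < l)
    {ς : Matrix (Fin 2 × Fin 2) (Fin 2 × Fin 2) ℂ} (hς : IsDensityMatrix ς) :
    IsOptimalResource uniform4 (noisyBell l ς) (bell 0) := by
  refine ⟨sum_normSq_bell 0, enablesOptimal_bell hl hς, fun m n τ hτ h => ⟨?_, ?_⟩⟩
  · rw [entanglementEntropy_bell]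
    refine one_le_entanglementEntropy hτ fun e he => ?_
    -- Projecting `τ` on `e` gives squared distance `1 - ⟨e|ρ|e⟩`, with `ρ` the reduced state, so
    -- `⟨e|ρ|e⟩ ≤ 1/2`.
    have h1 := h.half_le hl hς hτ e fun b => ∑ a, star (e a) * τ (a, b)
    rw [sum_norm_sub_prodVec τ hτ e he] at h1
    linarith
  · obtain ⟨hm, hn⟩ := h.two_le hl hς hτ
    exact Nat.mul_le_mul hm hn

end NoisyBell

open NoisyBell
theorem theorem6 (l : ℝ) (hl : l ∈ Set.Ioc (0 : ℝ) 1)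
    (ς : Matrix (Fin 2 × Fin 2) (Fin 2 × Fin 2) ℂ) (hς : IsDensityMatrix ς) :
    IsEntanglementCost uniform4 (noisyBell l ς) 1 ∧
      IsOptimalResource uniform4 (noisyBell l ς) (tau 0) ∧
      ∀ ε ∈ Set.Icc (0 : ℝ) 1, (EnablesOptimal uniform4 (noisyBell l ς) (tau ε) ↔ ε = 0) := by
  refine ⟨⟨2, 2, bell 0, isOptimalResource_bell hl.1 hς, entanglementEntropy_bell⟩, ?_,
    fun ε hε => ⟨fun h => h.eq_zero_of_tau hl.1 hς hε, ?_⟩⟩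
  · rw [tau_zero]
    exact isOptimalResource_bell hl.1 hς
  · rintro rfl
    rw [tau_zero]
    exact enablesOptimal_bell hl.1 hς
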